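/- Let $k$ be a field and let $E=(x^t,x^{t-1}y^{m_1},\dots,xy^{m_{t-1}},y^{m_t})\subset k[x,y]$, with $0=m_0\le m_1\le\dots\le m_t$, be a monomial ideal of finite positive colength $d$. Put $d_j=m_j-m_{j-1}$ for $1\le j\le t$. For $1\le i\le t+1$ and $1\le j\le t$ let $a_{i,j}=\sum_k a_{i,j,k}y^k$, where the $a_{i,j,k}$ are independent variables, with $0\le k<d_j$ if $i>j$ and $0\le k<d_i$ if $i\le j$. Let $k[\mathbf a]$ be the polynomial ring in all the $a_{i,j,k}$ and let $B=\operatorname{Spec}k[\mathbf a]$. Let $\mathcal M$ be the $(t+1)\times t$ matrix over $k[\mathbf a][x,y]$ whose $(i,j)$ entry is $a_{i,j}$, plus $y^{d_j}$ if $i=j$, minus $x$ if $i=j+1$. Let $I_t(\mathcal M)$ be the ideal generated by its maximal minors, and let $\pi\colon V(I_t(\mathcal M))\to B$ be the restriction of the projection $\mathbb A^2\times B\to B$. Let $\mathrm{res}_E\in k[\mathbf a][y]$ be the resultant with respect to $x$ of the two minors of $\mathcal M$ obtained by deleting the first row and the last row, respectively. Let $\mathbb G_m^2$ act on $B$ through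 the $\mathbb Z^2$-grading $\deg a_{i,j,k}=(i-j,\;m_j-m_{i-1}-k)$ of $k[\mathbf a]$ (that is, $\deg x=(1,0)$, $\deg y=(0,1)$, $\deg(a_{i,j,k}y^k)=(i-j,\;m_j-m_{i-1})$). Let $B'\subset B$ be the complement of the common vanishing locus of all the coefficients in $k[\mathbf a]$ of $\mathrm{res}_E$ as a polynomial in $y$. Then $B'$ is a $\mathbb G_m^2$-stable open subscheme of $B$, and $\pi$ is flat over $B'$. -/

import Mathlib

set_option maxSynthPendingDepth 3

open CategoryTheory AlgebraicGeometry Limits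
open scoped TensorProduct Polynomial

universe u

noncomputable section

namespace HilbertBurch

/-- `E = (x^t, x^(t-1) y^(m 1), …, x y^(m (t-1)), y^(m t))` with `0 = m 0 ≤ m 1 ≤ … ≤ m t`.
The ring `𝕜[x,y]` is written `𝕜[X][X]`: the outer variable is `x` and the inner variable is `y`. -/
structure IsStaircase {𝕜 : Type u} [Field 𝕜] (E : Ideal 𝕜[X][X]) (t : ℕ) (m : Fin (t + 1) → ℕ) :
    Prop where
  zero : m 0 = 0
  mono : Monotone m
  eq_span : E = Ideal.span (Set.range fun i : Fin (t + 1) ↦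
    (Polynomial.X : 𝕜[X][X]) ^ (t - (i : ℕ)) * Polynomial.C ((Polynomial.X : 𝕜[X]) ^ m i))

section

variable {t : ℕ} (m : Fin (t + 1) → ℕ)

/-- The differences `d_j = m_j - m_(j-1)`; rows, columns and the differences are numbered from `0`,
so the entry with index `j` here is `d_(j+1)` in the numbering from `1`. -/
def diff (j : Fin t) : ℕ := m j.succ - m j.castSucc

/-- The strict bound on the `y`-degree of the entry `a_(i,j)`: it is `d_j` below the diagonal
(`i > j`) and `d_i` on and above the diagonal (`i ≤ j`). -/
def degBound (i : Fin (t + 1)) (j : Fin t) : ℕ :=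
  if h : (j : ℕ) < i then diff m j else diff m ⟨i, (not_lt.mp h).trans_lt j.isLt⟩

/-- The index set of the parameters `a_(i,j,k)`, with `k < degBound m i j`. -/
abbrev ParamIdx : Type := Σ p : Fin (t + 1) × Fin t, Fin (degBound m p.1 p.2)

variable (𝕜 : Type u) [Field 𝕜]

/-- The polynomial ring `𝕜[𝐚]` in the parameters. -/
abbrev ParamRing : Type u := MvPolynomial (ParamIdx m) 𝕜

/-- The entry `a_(i,j) = ∑ₖ a_(i,j,k) y^k` in `𝕜[𝐚][y]`. -/
def paramEntry (i : Fin (t + 1)) (j : Fin t) : (ParamRing m 𝕜)[X] :=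
  ∑ k : Fin (degBound m i j), Polynomial.C (MvPolynomial.X ⟨(i, j), k⟩) * Polynomial.X ^ (k : ℕ)

/-- The spread out matrix, with `t + 1` rows and `t` columns and entries in `𝕜[𝐚][y][x]`: the entry
at `(i,j)` is `a_(i,j)`, plus `y^(d_i)` on the diagonal, minus `x` just below the diagonal. -/
def spreadMatrix : Matrix (Fin (t + 1)) (Fin t) (ParamRing m 𝕜)[X][X] :=
  Matrix.of fun i j ↦
    (if i = j.castSucc then Polynomial.C (Polynomial.X ^ diff m j) else 0)
      - (if i = j.succ then Polynomial.X else 0) + Polynomial.C (paramEntry m 𝕜 i j)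

/-- The `i`-th maximal minor: the determinant of the matrix with the `i`-th row removed. -/
def maxMinor (i : Fin (t + 1)) : (ParamRing m 𝕜)[X][X] :=
  ((spreadMatrix m 𝕜).submatrix i.succAbove id).det

/-- The ideal `I_t(ℳ)` of `𝕜[𝐚][x,y]` generated by the maximal minors. -/
def minorIdeal : Ideal (ParamRing m 𝕜)[X][X] := Ideal.span (Set.range (maxMinor m 𝕜))

/-- The resultant `res_E ∈ 𝕜[𝐚][y]`, with respect to `x`, of the first and the last minor. -/
def resE : (ParamRing m 𝕜)[X] :=
  Polynomial.resultant (maxMinor m 𝕜 0) (maxMinor m 𝕜 (Fin.last t))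

/-- The base `B = Spec 𝕜[𝐚]`. -/
abbrev base : Scheme.{u} := Spec (CommRingCat.of (ParamRing m 𝕜))

/-- The structure morphism `B ⟶ Spec 𝕜`. -/
abbrev baseStr : base m 𝕜 ⟶ Spec (CommRingCat.of 𝕜) :=
  Spec.map (CommRingCat.ofHom (algebraMap 𝕜 (ParamRing m 𝕜)))

/-- `𝔸² × B = Spec 𝕜[𝐚][x,y]`. -/
abbrev planeOverBase : Scheme.{u} := Spec (CommRingCat.of (ParamRing m 𝕜)[X][X])

/-- The projection `𝔸² × B ⟶ B`. -/
def planeProj : planeOverBase m 𝕜 ⟶ base m 𝕜 :=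
  Spec.map (CommRingCat.ofHom
    ((Polynomial.C : (ParamRing m 𝕜)[X] →+* (ParamRing m 𝕜)[X][X]).comp Polynomial.C))

/-- The closed subscheme `V(I_t(ℳ))` of `𝔸² × B`. -/
abbrev vanishing : Scheme.{u} :=
  Spec (CommRingCat.of ((ParamRing m 𝕜)[X][X] ⧸ minorIdeal m 𝕜))

/-- The closed immersion `V(I_t(ℳ)) ⟶ 𝔸² × B`. -/
def vanishingIncl : vanishing m 𝕜 ⟶ planeOverBase m 𝕜 :=
  Spec.map (CommRingCat.ofHom (Ideal.Quotient.mk (minorIdeal m 𝕜)))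

/-- The family `π : V(I_t(ℳ)) ⟶ B`. -/
def familyMap : vanishing m 𝕜 ⟶ base m 𝕜 := vanishingIncl m 𝕜 ≫ planeProj m 𝕜

/-- The locus `B'`: the complement of the common vanishing locus in `B` of the coefficients of
`res_E` as a polynomial in `y`. -/
def resLocus : Set (base m 𝕜) :=
  (PrimeSpectrum.zeroLocus (Set.range (resE m 𝕜).coeff))ᶜ

/-- The bidegree of the parameter `a_(i,j,k)`: since `y` has bidegree `(0,1)` and `a_(i,j)` has
bidegree `(i - j, m_j - m_(i-1))` in the numbering from `1`, it is
`(i - j, m_j - m_(i-1) - k)`. -/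
def bidegree (p : ParamIdx m) : ℤ × ℤ :=
  ((p.1.1 : ℤ) - (p.1.2 : ℤ), (m p.1.2.succ : ℤ) - (m p.1.1 : ℤ) - (p.2 : ℤ))

/-- The coordinate ring `𝕜[ℤ²] = 𝕜[u, u⁻¹, v, v⁻¹]` of the torus `𝔾ₘ²`. -/
abbrev TorusRing : Type u := AddMonoidAlgebra 𝕜 (ℤ × ℤ)

/-- The torus `𝔾ₘ²` over `𝕜`. -/
abbrev torus : Scheme.{u} := Spec (CommRingCat.of (TorusRing 𝕜))

/-- The structure morphism `𝔾ₘ² ⟶ Spec 𝕜`. -/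
abbrev torusStr : torus 𝕜 ⟶ Spec (CommRingCat.of 𝕜) :=
  Spec.map (CommRingCat.ofHom (algebraMap 𝕜 (TorusRing 𝕜)))

/-- The coaction of the grading: a parameter of bidegree `(p, q)` is sent to `u^p v^q` times
itself. -/
def coaction : ParamRing m 𝕜 →ₐ[𝕜] TorusRing 𝕜 ⊗[𝕜] ParamRing m 𝕜 :=
  MvPolynomial.aeval fun p ↦ AddMonoidAlgebra.single (bidegree m p) (1 : 𝕜) ⊗ₜ MvPolynomial.X p

/-- The coaction is counital. -/
lemma coaction_counit :
    (Algebra.TensorProduct.lid 𝕜 _).toAlgHom.comp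
      ((Algebra.TensorProduct.map (Bialgebra.counitAlgHom 𝕜 (TorusRing 𝕜)) (AlgHom.id 𝕜 _)).comp
        (coaction m 𝕜)) = AlgHom.id 𝕜 _ := by
  ext p; simp [coaction]

/-- The coaction is coassociative; with the previous fact, it defines an action of `𝔾ₘ²`. -/
lemma coaction_coassoc :
    (Algebra.TensorProduct.map (AlgHom.id 𝕜 (TorusRing 𝕜)) (coaction m 𝕜)).comp (coaction m 𝕜) =
      (Algebra.TensorProduct.assoc 𝕜 𝕜 𝕜 _ _ _).toAlgHom.comp
        ((Algebra.TensorProduct.map (Bialgebra.comulAlgHom 𝕜 (TorusRing 𝕜)) (AlgHom.id 𝕜 _)).comp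
          (coaction m 𝕜)) := by
  ext p; simp [coaction]

/-- The action morphism `𝔾ₘ² × B ⟶ B`. -/
def torusAction : pullback (torusStr 𝕜) (baseStr m 𝕜) ⟶ base m 𝕜 :=
  (pullbackSpecIso 𝕜 (TorusRing 𝕜) (ParamRing m 𝕜)).hom ≫
    Spec.map (CommRingCat.ofHom (coaction m 𝕜).toRingHom)

/-- An open subscheme `U` of `B` is `𝔾ₘ²`-stable if the action morphism maps the open subscheme
`𝔾ₘ² × U` of `𝔾ₘ² × B` into `U`. -/
def IsTorusStable (U : (base m 𝕜).Opens) : Prop :=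
  pullback.snd (torusStr 𝕜) (baseStr m 𝕜) ⁻¹ᵁ U ≤ torusAction m 𝕜 ⁻¹ᵁ U

end

end HilbertBurch

end

/-! Write `R` for the base ring, `T = R[y]`, and `f_i` for the minor without row `i`, rows being
numbered from 0. Row 0 of the matrix is free of `x` and the other rows form `N - x` with `N` over
`T`, so `f_0` is the characteristic polynomial of `N` up to sign. The relations `∑ ± M_ij f_i = 0`
rewrite each `x f_j` with `j ≥ 1`, so the ideal `I` of minors is `f_0 T[x] + ∑ T f_j`
(`IsPencil.exists_of_mem`). If `I` contains a nonzerodivisor of `T`, this expression of an element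
of `I` is unique (`IsPencil.eq_zero_of_sum_eq_zero`).

The resultant of `f_0` and `f_t` lies in `I` and in `T`. Once one of its coefficients is a unit, it
stays regular modulo every ideal `𝔞` of the base. Uniqueness modulo `𝔞` then puts the coefficients
of any element of `I ∩ 𝔞S`, with `S = T[x]`, in `𝔞`; hence `I ∩ 𝔞S ⊆ 𝔞I`, which gives flatness of
`S/I` (`IsPencil.flat`). The locus `B'` is covered by the opens where some coefficient is
invertible.

For stability, the matrix is bihomogeneous, hence so are its minors and their resultant; the
coaction multiplies each coefficient of `res_E` by a unit (`exists_coaction_coeff_resE`). -/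

namespace HilbertBurch

/-! ### Flatness criterion for quotients -/

/-- A quotient `S ⧸ I` of a flat algebra is flat as soon as `I ∩ 𝔞S ⊆ 𝔞I` for all ideals `𝔞` of
the base. -/
lemma flat_quotient_of_inf_le {A S : Type*} [CommRing A] [CommRing S] [Algebra A S]
    [Module.Flat A S] (I : Ideal S)
    (h : ∀ 𝔞 : Ideal A, I ⊓ 𝔞.map (algebraMap A S) ≤ 𝔞.map (algebraMap A S) * I) :
    Module.Flat A (S ⧸ I) := by
  rw [Module.Flat.iff_lift_lsmul_comp_subtype_injective]
  intro 𝔞 h𝔞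
  let q : S →ₗ[A] S ⧸ I := (Ideal.Quotient.mkₐ A I).toLinearMap
  have hq : Function.Surjective q := Ideal.Quotient.mk_surjective
  -- An element of `𝔞I` lifts to `𝔞 ⊗ S` through tensors `a ⊗ i` with `i ∈ I`, and these die in `𝔞 ⊗
  -- S/I`.
  have key : ∀ x ∈ 𝔞.map (algebraMap A S) * I, ∃ w : 𝔞 ⊗[A] S,
      TensorProduct.lift ((LinearMap.lsmul A S).comp 𝔞.subtype) w = x ∧ q.lTensor 𝔞 w = 0 := by
    have hadd : ∀ x y, (∃ w : 𝔞 ⊗[A] S,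
        TensorProduct.lift ((LinearMap.lsmul A S).comp 𝔞.subtype) w = x ∧ q.lTensor 𝔞 w = 0) →
        (∃ w : 𝔞 ⊗[A] S,
        TensorProduct.lift ((LinearMap.lsmul A S).comp 𝔞.subtype) w = y ∧ q.lTensor 𝔞 w = 0) →
        (∃ w : 𝔞 ⊗[A] S,
        TensorProduct.lift ((LinearMap.lsmul A S).comp 𝔞.subtype) w = x + y ∧
          q.lTensor 𝔞 w = 0) := by
      rintro x y ⟨w, rfl, hw⟩ ⟨w', rfl, hw'⟩
      exact ⟨w + w', map_add _ _ _, by rw [map_add, hw, hw', add_zero]⟩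
    intro x hx
    induction hx using Submodule.mul_induction_on' with
    | add x _ y _ hx hy => exact hadd _ _ hx hy
    | mem_mul_mem a ha i hi =>
      induction ha using Submodule.span_induction generalizing i with
      | zero => exact ⟨0, by simp, by simp⟩
      | add a b _ _ ha hb => rw [add_mul]; exact hadd _ _ (ha _ hi) (hb _ hi)
      | smul s a _ ha =>
        rw [smul_eq_mul, mul_comm s, mul_assoc]
        exact ha _ (I.mul_mem_left _ hi)
      | mem a ha =>
        obtain ⟨a, ha, rfl⟩ := ha
        refine ⟨⟨a, ha⟩ ⊗ₜ i, by simp [Algebra.smul_def], ?_⟩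
        have : q i = 0 := Ideal.Quotient.eq_zero_iff_mem.mpr hi
        simp [this]
  rw [injective_iff_map_eq_zero]
  intro z hz
  obtain ⟨w, rfl⟩ := LinearMap.lTensor_surjective 𝔞 hq z
  have hcomm : ∀ w : 𝔞 ⊗[A] S,
      TensorProduct.lift ((LinearMap.lsmul A (S ⧸ I)).comp 𝔞.subtype) (q.lTensor 𝔞 w) =
        q (TensorProduct.lift ((LinearMap.lsmul A S).comp 𝔞.subtype) w) := by
    intro w
    induction w using TensorProduct.induction_on with
    | zero => simp
    | tmul a s => simp
    | add x y hx hy => simp only [map_add, hx, hy]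
  rw [hcomm] at hz
  have h1 : TensorProduct.lift ((LinearMap.lsmul A S).comp 𝔞.subtype) w ∈ I :=
    Ideal.Quotient.eq_zero_iff_mem.mp hz
  have h2 : ∀ w : 𝔞 ⊗[A] S, TensorProduct.lift ((LinearMap.lsmul A S).comp 𝔞.subtype) w ∈
      𝔞.map (algebraMap A S) := by
    intro w
    induction w using TensorProduct.induction_on with
    | zero => simp
    | tmul a s =>
      simpa [Algebra.smul_def] using Ideal.mul_mem_right _ _ (Ideal.mem_map_of_mem _ a.2)
    | add x y hx hy => rw [map_add]; exact add_mem hx hy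
  obtain ⟨w', hw', hw0⟩ := key _ (h 𝔞 ⟨h1, h2 w⟩)
  -- Flatness of `S` identifies the given lift `w` with the lift `w'` that dies.
  rw [← Module.Flat.iff_lift_lsmul_comp_subtype_injective.mp ‹Module.Flat A S› h𝔞 hw', hw0]

/-! ### Maximal minors of a pencil -/

section Minors

variable {A : Type*} [CommRing A] {t : ℕ}

/-- The maximal minor of a `(t + 1) × t` matrix obtained by removing the `i`-th row. -/
def rowMinor {B : Type*} [CommRing B] (M : Matrix (Fin (t + 1)) (Fin t) B) (i : Fin (t + 1)) : B :=
  (M.submatrix i.succAbove id).det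

/-- Repeating column `j` in front gives a square matrix with two equal columns; its vanishing
determinant is expanded along the new column. -/
lemma sum_rowMinor {B : Type*} [CommRing B] (M : Matrix (Fin (t + 1)) (Fin t) B) (j : Fin t) :
    ∑ i : Fin (t + 1), (-1) ^ (i : ℕ) * M i j * rowMinor M i = 0 := by
  have h : (Matrix.of fun i ↦ (Fin.cons (M i j) (M i) : Fin (t + 1) → B)).det = 0 :=
    Matrix.det_zero_of_column_eq (i := 0) (j := j.succ) (Fin.succ_ne_zero _).symm (by simp)
  rw [Matrix.det_succ_column_zero] at h
  simpa [rowMinor, Matrix.submatrix] using h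

lemma rowMinor_map {B B' : Type*} [CommRing B] [CommRing B'] (φ : B →+* B')
    (M : Matrix (Fin (t + 1)) (Fin t) B) (i : Fin (t + 1)) :
    rowMinor (M.map φ) i = φ (rowMinor M i) := by
  simp [rowMinor, RingHom.map_det, Matrix.submatrix_map]

lemma map_span_rowMinor {B B' : Type*} [CommRing B] [CommRing B'] (φ : B →+* B')
    (M : Matrix (Fin (t + 1)) (Fin t) B) :
    (Ideal.span (Set.range (rowMinor M))).map φ = Ideal.span (Set.range (rowMinor (M.map φ))) := by
  rw [Ideal.map_span, ← Set.range_comp]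
  congr 2
  ext i
  simp [rowMinor_map]

/-- The `(t + 1) × t` matrices whose first row is constant in `X` and whose other rows form a
matrix `N - X`, with `N` constant in `X`. -/
structure IsPencil {T : Type*} [CommRing T] (M : Matrix (Fin (t + 1)) (Fin t) T[X]) : Prop where
  exists_zero : ∃ r : Fin t → T, ∀ j, M 0 j = Polynomial.C (r j)
  exists_succ : ∃ N : Matrix (Fin t) (Fin t) T, ∀ i j,
    M i.succ j = Polynomial.C (N i j) - if i = j then Polynomial.X else 0

namespace IsPencil

variable {T : Type*} [CommRing T] {M : Matrix (Fin (t + 1)) (Fin t) T[X]}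

lemma map {T' : Type*} [CommRing T'] (hM : IsPencil M) (φ : T →+* T') :
    IsPencil (M.map (Polynomial.mapRingHom φ)) := by
  obtain ⟨⟨r, hr⟩, N, hN⟩ := hM
  refine ⟨⟨φ ∘ r, fun j ↦ by simp [hr]⟩, N.map φ, fun i j ↦ ?_⟩
  simp only [Matrix.map_apply, hN, Polynomial.coe_mapRingHom]
  split_ifs <;> simp

/-- The first minor is the characteristic polynomial up to sign. -/
lemma exists_charpoly (hM : IsPencil M) :
    ∃ N : Matrix (Fin t) (Fin t) T, rowMinor M 0 = (-1) ^ t * N.charpoly := by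
  obtain ⟨-, N, hN⟩ := hM
  refine ⟨N, ?_⟩
  have : M.submatrix (Fin.succAbove 0) id = -N.charmatrix := by
    ext1 i j
    simp [hN, Matrix.charmatrix, Matrix.diagonal_apply, Matrix.scalar_apply]
  rw [rowMinor, this, Matrix.det_neg, Fintype.card_fin, Matrix.charpoly]

/-- The ideal of maximal minors is generated by the first minor as an ideal, together with
the other minors as a module over the constants. -/
lemma exists_of_mem (hM : IsPencil M) {p : T[X]} (hp : p ∈ Ideal.span (Set.range (rowMinor M))) :
    ∃ (q : T[X]) (v : Fin t → T),
      p = rowMinor M 0 * q + ∑ j, Polynomial.C (v j) * rowMinor M (Fin.succ j) := by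
  obtain ⟨⟨r, hr⟩, N, hN⟩ := hM
  -- In the relation from column `j`, the variable `X` occurs only in row `j + 1`, so the relation
  -- can be solved for `X` times that minor; the sign is its own inverse.
  have hX : ∀ j : Fin t, ∃ (q : T[X]) (v : Fin t → T), Polynomial.X * rowMinor M j.succ =
      rowMinor M 0 * q + ∑ j, Polynomial.C (v j) * rowMinor M (Fin.succ j) := by
    intro j
    have h := sum_rowMinor M j
    rw [Fin.sum_univ_succ] at h
    simp only [hr, hN, Fin.val_zero, pow_zero, one_mul, Fin.val_succ, mul_sub, sub_mul,
      Finset.sum_sub_distrib, mul_ite, ite_mul, mul_zero, zero_mul, Finset.sum_ite_eq',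
      Finset.mem_univ, if_true] at h
    have hs : ((-1) ^ ((j : ℕ) + 1) * (-1) ^ ((j : ℕ) + 1) : T[X]) = 1 := by
      rw [← mul_pow]; simp
    refine ⟨(-1) ^ ((j : ℕ) + 1) * Polynomial.C (r j),
      fun i ↦ (-1) ^ ((j : ℕ) + 1) * ((-1) ^ ((i : ℕ) + 1) * N i j), ?_⟩
    simp only [map_mul, map_pow, map_neg, map_one, mul_assoc, ← Finset.mul_sum] at h ⊢
    linear_combination (-(-1) ^ ((j : ℕ) + 1)) * h - Polynomial.X * rowMinor M j.succ * hs
  have hadd : ∀ a b : T[X], (∃ (q : T[X]) (v : Fin t → T),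
      a = rowMinor M 0 * q + ∑ j, Polynomial.C (v j) * rowMinor M (Fin.succ j)) →
      (∃ (q : T[X]) (v : Fin t → T),
      b = rowMinor M 0 * q + ∑ j, Polynomial.C (v j) * rowMinor M (Fin.succ j)) →
      (∃ (q : T[X]) (v : Fin t → T),
      a + b = rowMinor M 0 * q + ∑ j, Polynomial.C (v j) * rowMinor M (Fin.succ j)) := by
    rintro a b ⟨q, v, rfl⟩ ⟨q', v', rfl⟩
    refine ⟨q + q', v + v', ?_⟩
    simp only [Pi.add_apply, map_add, add_mul, Finset.sum_add_distrib]
    ring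
  have hC : ∀ (c : T) (a : T[X]), (∃ (q : T[X]) (v : Fin t → T),
      a = rowMinor M 0 * q + ∑ j, Polynomial.C (v j) * rowMinor M (Fin.succ j)) →
      (∃ (q : T[X]) (v : Fin t → T),
      Polynomial.C c * a =
        rowMinor M 0 * q + ∑ j, Polynomial.C (v j) * rowMinor M (Fin.succ j)) := by
    rintro c a ⟨q, v, rfl⟩
    refine ⟨Polynomial.C c * q, c • v, ?_⟩
    simp only [Pi.smul_apply, smul_eq_mul, map_mul, mul_add, Finset.mul_sum, mul_assoc]
    ring
  have hsum : ∀ (s : Finset (Fin t)) (b : Fin t → T[X]), (∀ i, (∃ (q : T[X]) (v : Fin t → T),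
      b i = rowMinor M 0 * q + ∑ j, Polynomial.C (v j) * rowMinor M (Fin.succ j))) →
      (∃ (q : T[X]) (v : Fin t → T),
      ∑ i ∈ s, b i = rowMinor M 0 * q + ∑ j, Polynomial.C (v j) * rowMinor M (Fin.succ j)) := by
    intro s b hb
    exact Finset.sum_induction _ _ hadd ⟨0, 0, by simp⟩ fun i _ ↦ hb i
  have hXa : ∀ a : T[X], (∃ (q : T[X]) (v : Fin t → T),
      a = rowMinor M 0 * q + ∑ j, Polynomial.C (v j) * rowMinor M (Fin.succ j)) →
      (∃ (q : T[X]) (v : Fin t → T),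
      Polynomial.X * a =
        rowMinor M 0 * q + ∑ j, Polynomial.C (v j) * rowMinor M (Fin.succ j)) := by
    rintro a ⟨q, v, rfl⟩
    rw [mul_add, Finset.mul_sum]
    refine hadd _ _ ⟨Polynomial.X * q, 0, by simp; ring⟩ (hsum _ _ fun i ↦ ?_)
    rw [mul_left_comm]
    exact hC _ _ (hX i)
  induction hp using Submodule.span_induction with
  | zero => exact ⟨0, 0, by simp⟩
  | add a b _ _ ha hb => exact hadd _ _ ha hb
  | mem a ha =>
    obtain ⟨i, rfl⟩ := ha
    cases i using Fin.cases with
    | zero => exact ⟨1, 0, by simp⟩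
    | succ j => exact ⟨0, Pi.single j 1, by simp [Pi.single_apply, apply_ite, ite_mul]⟩
  | smul q a _ ha =>
    rw [smul_eq_mul]
    induction q using Polynomial.induction_on with
    | C c => exact hC _ _ ha
    | add p q hp hq => rw [add_mul]; exact hadd _ _ hp hq
    | monomial n c h =>
      rw [pow_succ, ← mul_assoc, mul_comm _ Polynomial.X, mul_assoc]
      exact hXa _ h

/-- If the ideal of maximal minors contains a regular constant, then the expression of its
elements is unique. -/
lemma eq_zero_of_sum_eq_zero (hM : IsPencil M) {s : T} (hs : s ∈ nonZeroDivisors T)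
    (hsI : Polynomial.C s ∈ Ideal.span (Set.range (rowMinor M))) {q : T[X]} {v : Fin t → T}
    (h : rowMinor M 0 * q + ∑ j, Polynomial.C (v j) * rowMinor M (Fin.succ j) = 0) :
    q = 0 ∧ v = 0 := by
  nontriviality T
  obtain ⟨N, hN⟩ := hM.exists_charpoly
  have hmon := N.charpoly_monic
  have hdeg : N.charpoly.degree = t := by simp
  have hf : ∀ q : T[X], (rowMinor M 0 * q) %ₘ N.charpoly = 0 := by
    intro q
    rw [Polynomial.modByMonic_eq_zero_iff_dvd hmon, hN]
    exact Dvd.dvd.mul_right (Dvd.intro_left _ rfl) _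
  have hmod : ∀ (q : T[X]) (v : Fin t → T) (i : ℕ),
      ((rowMinor M 0 * q + ∑ j, Polynomial.C (v j) * rowMinor M (Fin.succ j)) %ₘ
        N.charpoly).coeff i = ∑ j, v j * (rowMinor M (Fin.succ j) %ₘ N.charpoly).coeff i := by
    intro q v i
    have : ∀ p, p %ₘ N.charpoly = Polynomial.modByMonicHom N.charpoly p := fun _ ↦ rfl
    rw [Polynomial.add_modByMonic, hf, zero_add, this, map_sum, Polynomial.finsetSum_coeff]
    refine Finset.sum_congr rfl fun j _ ↦ ?_
    rw [← Polynomial.smul_eq_C_mul, map_smul, Polynomial.coeff_smul, smul_eq_mul]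
    rfl
  -- Row `j` holds the coefficients of the minor `j + 1` modulo the characteristic polynomial.
  let H : Matrix (Fin t) (Fin t) T := fun j i ↦ (rowMinor M (Fin.succ j) %ₘ N.charpoly).coeff i
  have hk : ∀ k : Fin t, ∃ (q : T[X]) (v : Fin t → T), Polynomial.X ^ (k : ℕ) * Polynomial.C s =
      rowMinor M 0 * q + ∑ j, Polynomial.C (v j) * rowMinor M (Fin.succ j) :=
    fun k ↦ hM.exists_of_mem (Ideal.mul_mem_left _ _ hsI)
  choose qk c hc using hk
  -- Each `X ^ k * C s` with `k < t` lies in the ideal and is its own remainder, so `H` has a left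
  -- inverse up to the factor `s`. Hence `det H` divides `s ^ t` and is regular.
  have hcH : Matrix.of c * H = s • 1 := by
    ext k i
    have h1 := hmod (qk k) (c k) i
    rw [← hc k, (Polynomial.modByMonic_eq_self_iff hmon).mpr, Polynomial.coeff_mul_C,
      Polynomial.coeff_X_pow] at h1
    · rw [Matrix.mul_apply]
      simp only [Matrix.of_apply, H]
      rw [← h1]
      simp [Matrix.one_apply, Fin.ext_iff, eq_comm]
    · rw [hdeg]
      refine (Polynomial.degree_mul_le _ _).trans_lt ?_
      rw [Polynomial.degree_X_pow]
      refine lt_of_le_of_lt (add_le_add_right Polynomial.degree_C_le _) ?_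
      simp
  have hdet : H.det ∈ nonZeroDivisors T := by
    have h2 := congrArg Matrix.det hcH
    rw [Matrix.det_mul, Matrix.det_smul, Matrix.det_one, mul_one] at h2
    have h3 : (Matrix.of c).det * H.det ∈ nonZeroDivisors T := by
      rw [h2]; exact pow_mem hs _
    exact (mul_mem_nonZeroDivisors.mp h3).2
  have hvH : Matrix.vecMul v H = 0 := by
    ext i
    have h1 := hmod q v i
    rw [h, Polynomial.zero_modByMonic, Polynomial.coeff_zero] at h1
    exact h1.symm
  have hv : v = 0 := by
    have h1 := congrArg (fun w ↦ Matrix.vecMul w H.adjugate) hvH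
    simp only [Matrix.vecMul_vecMul, Matrix.mul_adjugate, Matrix.zero_vecMul,
      Matrix.vecMul_smul, Matrix.vecMul_one] at h1
    ext j
    have h2 := congrFun h1 j
    simp only [Pi.smul_apply, smul_eq_mul, Pi.zero_apply] at h2
    exact (mem_nonZeroDivisors_iff.mp hdet).1 _ h2
  refine ⟨?_, hv⟩
  simp only [hv, Pi.zero_apply, map_zero, zero_mul, Finset.sum_const_zero, add_zero, hN,
    mul_assoc] at h
  have h1 : N.charpoly * q = 0 := by
    have h2 := congrArg ((-1) ^ t * ·) h
    simpa [← mul_assoc, ← mul_pow] using h2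
  exact (hmon.mul_right_eq_zero_iff).mp h1

end IsPencil

/-- By McCoy, regularity need only be tested against constants, and a constant killing the
polynomial kills its unit coefficient. Unlike mere regularity, this hypothesis survives every
quotient of the base. -/
lemma mem_nonZeroDivisors_of_isUnit_coeff {A : Type*} [CommRing A] {s : A[X]} {k : ℕ}
    (hs : IsUnit (s.coeff k)) : s ∈ nonZeroDivisors A[X] := by
  rw [Polynomial.mem_nonZeroDivisors_iff]
  intro a ha
  have h := congrArg (Polynomial.coeff · k) ha
  simpa [hs.mul_left_eq_zero] using h

lemma ker_mapRingHom_mapRingHom_mk (𝔞 : Ideal A) :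
    RingHom.ker (Polynomial.mapRingHom (Polynomial.mapRingHom (Ideal.Quotient.mk 𝔞))) =
      𝔞.map (algebraMap A A[X][X]) := by
  rw [Polynomial.ker_mapRingHom, Polynomial.ker_mapRingHom, Ideal.mk_ker, Ideal.map_map]
  rfl

/-- The quotient by the maximal minors is flat over the base if the ideal of minors contains a
polynomial in `y` one of whose coefficients is invertible. -/
theorem IsPencil.flat {M : Matrix (Fin (t + 1)) (Fin t) A[X][X]} (hM : IsPencil M) {s : A[X]}
    (hsI : Polynomial.C s ∈ Ideal.span (Set.range (rowMinor M))) {k : ℕ}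
    (hs : IsUnit (s.coeff k)) :
    Module.Flat A (A[X][X] ⧸ Ideal.span (Set.range (rowMinor M))) := by
  have : Module.Free A A[X][X] := Module.Free.trans (S := A[X])
  refine flat_quotient_of_inf_le _ fun 𝔞 p hp ↦ ?_
  obtain ⟨q, v, rfl⟩ := hM.exists_of_mem hp.1
  let φ := Polynomial.mapRingHom (Ideal.Quotient.mk 𝔞)
  let Φ := Polynomial.mapRingHom φ
  have hker := ker_mapRingHom_mapRingHom_mk 𝔞
  have h0 : Φ (rowMinor M 0 * q + ∑ j, Polynomial.C (v j) * rowMinor M (Fin.succ j)) = 0 := by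
    rw [← RingHom.mem_ker, hker]; exact hp.2
  have hsI' : Polynomial.C (φ s) ∈ Ideal.span (Set.range (rowMinor (M.map Φ))) := by
    rw [← map_span_rowMinor]
    simpa [Φ] using Ideal.mem_map_of_mem Φ hsI
  have hs' : φ s ∈ nonZeroDivisors (A ⧸ 𝔞)[X] := by
    refine mem_nonZeroDivisors_of_isUnit_coeff (k := k) ?_
    simpa [φ] using hs.map (Ideal.Quotient.mk 𝔞)
  simp only [map_add, map_mul, map_sum, ← rowMinor_map] at h0
  -- Uniqueness over `A ⧸ 𝔞`: `q` and all `v j` vanish modulo `𝔞`.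
  have h1 := (hM.map φ).eq_zero_of_sum_eq_zero hs' hsI' (q := Φ q) (v := fun j ↦ φ (v j))
    (by simpa [Φ] using h0)
  refine add_mem ?_ (sum_mem fun j _ ↦ ?_)
  · rw [mul_comm (rowMinor M 0)]
    refine Ideal.mul_mem_mul ?_ (Ideal.subset_span (Set.mem_range_self _))
    rw [← hker]
    exact h1.1
  · refine Ideal.mul_mem_mul ?_ (Ideal.subset_span (Set.mem_range_self _))
    rw [← hker, RingHom.mem_ker]
    simpa [φ] using congrFun h1.2 j

end Minors

/-! ### The resultant in the ideal of minors -/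

lemma IsPencil.C_resultant_mem {t : ℕ} {T : Type*} [CommRing T]
    {M : Matrix (Fin (t + 1)) (Fin t) T[X]} (hM : IsPencil M) (i : Fin (t + 1)) :
    Polynomial.C (Polynomial.resultant (rowMinor M 0) (rowMinor M i)) ∈
      Ideal.span (Set.range (rowMinor M)) := by
  nontriviality T
  -- The Bézout identity for the resultant needs a factor of positive degree; for `t = 0` the empty
  -- minor already generates the unit ideal.
  rcases Nat.eq_zero_or_pos t with rfl | ht
  · have h : rowMinor M 0 = 1 := Matrix.det_isEmpty
    have : (1 : T[X]) ∈ Ideal.span (Set.range (rowMinor M)) :=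
      h ▸ Ideal.subset_span (Set.mem_range_self 0)
    rw [(Ideal.eq_top_iff_one _).mpr this]
    trivial
  · obtain ⟨N, hN⟩ := hM.exists_charpoly
    have hdeg : (rowMinor M 0).natDegree ≠ 0 := by
      have hu : ((-1) ^ t : T[X]) = Polynomial.C ((-1) ^ t) := by simp
      rw [hN, hu, Polynomial.natDegree_C_mul_of_isUnit (isUnit_one.neg.pow t),
        N.charpoly_natDegree_eq_dim, Fintype.card_fin]
      exact ht.ne'
    obtain ⟨p, q, -, -, h⟩ := Polynomial.exists_mul_add_mul_eq_C_resultant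
      (rowMinor M 0) (rowMinor M i) le_rfl le_rfl (Or.inl hdeg)
    rw [← h]
    exact add_mem (Ideal.mul_mem_right _ _ (Ideal.subset_span (Set.mem_range_self _)))
      (Ideal.mul_mem_right _ _ (Ideal.subset_span (Set.mem_range_self _)))

section

variable {t : ℕ} (m : Fin (t + 1) → ℕ) (𝕜 : Type u) [Field 𝕜]

lemma isPencil_spreadMatrix : IsPencil (spreadMatrix m 𝕜) := by
  refine ⟨⟨fun j ↦ (if 0 = j.castSucc then Polynomial.X ^ diff m j else 0) + paramEntry m 𝕜 0 j,
    fun j ↦ ?_⟩, Matrix.of fun i j ↦ (if i.succ = j.castSucc then Polynomial.X ^ diff m j else 0) +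
      paramEntry m 𝕜 i.succ j, fun i j ↦ ?_⟩
  · simp [spreadMatrix, (Fin.succ_ne_zero j).symm, apply_ite Polynomial.C]
  · simp only [spreadMatrix, Matrix.of_apply, Fin.succ_inj, map_add, apply_ite Polynomial.C,
      map_zero]
    ring

lemma C_resE_mem : Polynomial.C (resE m 𝕜) ∈ minorIdeal m 𝕜 :=
  (isPencil_spreadMatrix m 𝕜).C_resultant_mem (Fin.last t)

end

/-! ### Resultants under scaling of the variables -/

section Scaling

variable {R : Type*} [CommRing R] (a b : R)

/-- The substitution `y ↦ b y`. -/
noncomputable def scaleVar : R[X] →+* R[X] :=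
  Polynomial.eval₂RingHom Polynomial.C (Polynomial.C b * Polynomial.X)

/-- The substitution `x ↦ a x`, `y ↦ b y`. -/
noncomputable def scaleVars : R[X][X] →+* R[X][X] :=
  Polynomial.eval₂RingHom (Polynomial.C.comp (scaleVar b))
    (Polynomial.C (Polynomial.C a) * Polynomial.X)

@[simp] lemma scaleVar_C (r : R) : scaleVar b (Polynomial.C r) = Polynomial.C r := by
  simp [scaleVar]

@[simp] lemma scaleVar_X : scaleVar b Polynomial.X = Polynomial.C b * Polynomial.X := by
  simp [scaleVar]

lemma coeff_scaleVar (p : R[X]) (n : ℕ) : (scaleVar b p).coeff n = p.coeff n * b ^ n := by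
  induction p using Polynomial.induction_on' with
  | add p q hp hq => simp [hp, hq, add_mul]
  | monomial k r =>
    simp only [scaleVar, Polynomial.coe_eval₂RingHom, Polynomial.eval₂_monomial, mul_pow,
      ← Polynomial.C_pow, Polynomial.coeff_C_mul, Polynomial.coeff_X_pow,
      Polynomial.coeff_monomial]
    by_cases h : n = k
    · simp [h]
    · simp [h, Ne.symm h]

@[simp] lemma scaleVars_C (p : R[X]) :
    scaleVars a b (Polynomial.C p) = Polynomial.C (scaleVar b p) := by
  simp [scaleVars]

@[simp] lemma scaleVars_X :
    scaleVars a b Polynomial.X = Polynomial.C (Polynomial.C a) * Polynomial.X := by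
  simp [scaleVars]

lemma coeff_scaleVars (p : R[X][X]) (n : ℕ) :
    (scaleVars a b p).coeff n = scaleVar b (p.coeff n) * Polynomial.C a ^ n := by
  induction p using Polynomial.induction_on' with
  | add p q hp hq => simp [hp, hq, add_mul]
  | monomial k r =>
    simp only [scaleVars, Polynomial.coe_eval₂RingHom, Polynomial.eval₂_monomial, mul_pow,
      ← Polynomial.C_pow, Polynomial.coeff_C_mul, Polynomial.coeff_X_pow,
      Polynomial.coeff_monomial, RingHom.comp_apply]
    by_cases h : n = k
    · simp [h]
    · simp [h, Ne.symm h]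

lemma scaleVar_injective (hb : IsUnit b) : Function.Injective (scaleVar b) := by
  intro p q h
  ext n
  have h' := congrArg (Polynomial.coeff · n) h
  simp only [coeff_scaleVar] at h'
  exact (hb.pow n).mul_right_cancel h'

/-- Up to a unit, the substitution `x ↦ a x` is given by scaling the roots. -/
lemma exists_scaleVars_eq (ha : IsUnit a) (p : R[X][X]) : ∃ e : R, IsUnit e ∧
    scaleVars a b p = Polynomial.C (Polynomial.C e) *
      (p.map (scaleVar b)).scaleRoots (Polynomial.C (Ring.inverse a)) := by
  refine ⟨a ^ (p.map (scaleVar b)).natDegree, ha.pow _, ?_⟩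
  ext1 n
  rw [coeff_scaleVars, Polynomial.coeff_C_mul, Polynomial.coeff_scaleRoots, Polynomial.coeff_map]
  rcases le_or_gt n (p.map (scaleVar b)).natDegree with h | h
  · obtain ⟨k, hk⟩ := Nat.exists_eq_add_of_le h
    rw [hk, Nat.add_sub_cancel_left, mul_left_comm, ← map_pow, ← map_pow, ← map_mul, pow_add,
      mul_assoc, ← mul_pow, Ring.mul_inverse_cancel a ha, one_pow, mul_one]
  · have h0 := Polynomial.coeff_eq_zero_of_natDegree_lt h
    rw [Polynomial.coeff_map] at h0
    simp [h0]

/-- The resultant with respect to `x` is homogeneous. -/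
lemma exists_resultant_eq {S : Type*} [CommRing S] {ι γ : S →+* R} (hι : Function.Injective ι)
    (ha : IsUnit a) (hb : IsUnit b) {f g : S[X][X]} {e₁ e₂ : R} (he₁ : IsUnit e₁) (he₂ : IsUnit e₂)
    (hf : f.map (Polynomial.mapRingHom γ) = Polynomial.C (Polynomial.C e₁) *
      scaleVars a b (f.map (Polynomial.mapRingHom ι)))
    (hg : g.map (Polynomial.mapRingHom γ) = Polynomial.C (Polynomial.C e₂) *
      scaleVars a b (g.map (Polynomial.mapRingHom ι))) :
    ∃ e : R, IsUnit e ∧ (f.resultant g).map γ =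
      Polynomial.C e * scaleVar b ((f.resultant g).map ι) := by
  obtain ⟨d₁, hd₁, h₁⟩ := exists_scaleVars_eq a b ha (f.map (Polynomial.mapRingHom ι))
  obtain ⟨d₂, hd₂, h₂⟩ := exists_scaleVars_eq a b ha (g.map (Polynomial.mapRingHom ι))
  -- Injectivity keeps the degree in `x`, on which both the resultant and `scaleRoots` depend.
  have hinj : Function.Injective ((scaleVar b).comp (Polynomial.mapRingHom ι)) := by
    rw [RingHom.coe_comp, Polynomial.coe_mapRingHom]
    exact (scaleVar_injective b hb).comp (Polynomial.map_injective ι hι)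
  rw [Polynomial.map_map] at h₁ h₂
  rw [h₁, ← mul_assoc, ← map_mul, ← map_mul] at hf
  rw [h₂, ← mul_assoc, ← map_mul, ← map_mul] at hg
  have hs := Polynomial.resultant_scaleRoots
    (f.map ((scaleVar b).comp (Polynomial.mapRingHom ι)))
    (g.map ((scaleVar b).comp (Polynomial.mapRingHom ι))) (Polynomial.C (Ring.inverse a))
  simp only [Polynomial.natDegree_scaleRoots, Polynomial.natDegree_map_eq_of_injective hinj,
    Polynomial.resultant_map_map] at hs
  refine ⟨(e₁ * d₁) ^ g.natDegree * ((e₂ * d₂) ^ f.natDegree *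
    Ring.inverse a ^ (f.natDegree * g.natDegree)),
    ((he₁.mul hd₁).pow _).mul (((he₂.mul hd₂).pow _).mul (ha.ringInverse.pow _)), ?_⟩
  rw [← Polynomial.coe_mapRingHom γ, ← Polynomial.resultant_map_map, hf, hg,
    Polynomial.resultant_C_mul_left, Polynomial.resultant_C_mul_right, hs]
  simp only [map_mul, map_pow, RingHom.comp_apply, Polynomial.coe_mapRingHom, mul_assoc]

end Scaling

/-! ### Bihomogeneity of the minors and the resultant -/

section Torus

variable {t : ℕ} (m : Fin (t + 1) → ℕ) (𝕜 : Type u) [Field 𝕜]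

/-- The minors are homogeneous: two specialisations of the parameters which differ by a character
`w` acting through the bidegree have the same minors, up to units and a scaling of `x` and `y`. -/
lemma exists_maxMinor_map_eq (hm : Monotone m) {R : Type*} [CommRing R] {ι γ : ParamRing m 𝕜 →+* R}
    (w : ℤ × ℤ → R) (w0 : w 0 = 1) (wadd : ∀ a b, w (a + b) = w a * w b)
    (hX : ∀ p, γ (MvPolynomial.X p) = w (bidegree m p) * ι (MvPolynomial.X p)) (i : Fin (t + 1)) :
    ∃ e : R, IsUnit e ∧ (maxMinor m 𝕜 i).map (Polynomial.mapRingHom γ) =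
      Polynomial.C (Polynomial.C e) * scaleVars (w (-1, 0)) (w (0, -1))
        ((maxMinor m 𝕜 i).map (Polynomial.mapRingHom ι)) := by
  have hu : ∀ a, IsUnit (w a) := fun a ↦ IsUnit.of_mul_eq_one (w (-a)) (by rw [← wadd]; simp [w0])
  have wpow : ∀ a (n : ℕ), w a ^ n = w (n • a) := by
    intro a n
    induction n with
    | zero => simp [w0]
    | succ n ih => rw [pow_succ, ih, succ_nsmul, wadd]
  -- The bidegree of entry `(i,j)` splits into a row weight and a column weight, so the torus acts
  -- by rescaling rows, columns and the two variables.
  let α : Fin (t + 1) → R := fun i ↦ w (i, -(m i : ℤ))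
  let β : Fin t → R := fun j ↦ w (-(j : ℤ), m j.succ)
  have hentry : ∀ i j, (spreadMatrix m 𝕜 i j).map (Polynomial.mapRingHom γ) =
      Polynomial.C (Polynomial.C (α i)) * (Polynomial.C (Polynomial.C (β j)) *
        scaleVars (w (-1, 0)) (w (0, -1))
          ((spreadMatrix m 𝕜 i j).map (Polynomial.mapRingHom ι))) := by
    intro i j
    have hp : (paramEntry m 𝕜 i j).map γ = Polynomial.C (α i) * (Polynomial.C (β j) *
        scaleVar (w (0, -1)) ((paramEntry m 𝕜 i j).map ι)) := by
      simp only [paramEntry, Polynomial.map_sum, Polynomial.map_mul, Polynomial.map_C,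
        Polynomial.map_pow, Polynomial.map_X, map_sum, map_mul, map_pow, scaleVar_C, scaleVar_X,
        Finset.mul_sum]
      refine Finset.sum_congr rfl fun k _ ↦ ?_
      have : w (bidegree m ⟨(i, j), k⟩) = α i * β j * w (0, -1) ^ (k : ℕ) := by
        simp only [α, β, wpow, ← wadd]
        congr 1
        ext <;> simp [bidegree] <;> ring
      rw [hX, this]
      simp only [map_mul, map_pow]
      ring
    have hd : (Polynomial.map (Polynomial.mapRingHom γ)
        (if i = j.castSucc then Polynomial.C (Polynomial.X ^ diff m j) else 0)) =
        Polynomial.C (Polynomial.C (α i)) * (Polynomial.C (Polynomial.C (β j)) *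
        scaleVars (w (-1, 0)) (w (0, -1)) (Polynomial.map (Polynomial.mapRingHom ι)
        (if i = j.castSucc then Polynomial.C (Polynomial.X ^ diff m j) else 0))) := by
      split_ifs with h
      · have : α i * β j * w (0, -1) ^ diff m j = 1 := by
          simp only [α, β, wpow, ← wadd, h, ← w0]
          congr 1
          -- Monotonicity makes the truncated subtraction in `diff` a true difference.
          have := hm (Fin.castSucc_lt_succ (i := j)).le
          ext
          · simp
          · simp [diff, Nat.cast_sub this]
        have hC := congrArg Polynomial.C this
        simp only [Polynomial.map_C, Polynomial.coe_mapRingHom, Polynomial.map_pow,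
          Polynomial.map_X, scaleVars_C, map_pow, scaleVar_X]
        rw [← Polynomial.C_pow, ← Polynomial.C_pow, ← Polynomial.C_mul, ← Polynomial.C_mul]
        congr 1
        simp only [map_mul, map_pow, map_one] at hC
        rw [mul_pow]
        linear_combination (-Polynomial.X ^ diff m j) * hC
      · simp
    have hx : (Polynomial.map (Polynomial.mapRingHom γ)
        (if i = j.succ then Polynomial.X else 0)) =
        Polynomial.C (Polynomial.C (α i)) * (Polynomial.C (Polynomial.C (β j)) *
        scaleVars (w (-1, 0)) (w (0, -1)) (Polynomial.map (Polynomial.mapRingHom ι)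
        (if i = j.succ then Polynomial.X else 0))) := by
      split_ifs with h
      · have : α i * β j * w (-1, 0) = 1 := by
          simp only [α, β, ← wadd, h, ← w0]
          congr 1
          ext <;> simp
        simp only [Polynomial.map_X, scaleVars_X]
        rw [← mul_assoc, ← mul_assoc, ← Polynomial.C_mul, ← Polynomial.C_mul, ← Polynomial.C_mul,
          ← Polynomial.C_mul, this]
        simp
      · simp
    simp only [spreadMatrix, Matrix.of_apply, Polynomial.map_add, Polynomial.map_sub, map_add,
      map_sub, mul_add, mul_sub, hd, hx]
    simp [hp]
  refine ⟨(∏ k : Fin t, α (i.succAbove k)) * ∏ k, β k,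
    (IsUnit.prod_univ_iff.mpr fun _ ↦ hu _).mul (IsUnit.prod_univ_iff.mpr fun _ ↦ hu _), ?_⟩
  have hmap : ∀ δ : ParamRing m 𝕜 →+* R, (maxMinor m 𝕜 i).map (Polynomial.mapRingHom δ) =
      (Matrix.of fun k j ↦ (spreadMatrix m 𝕜 (i.succAbove k) j).map
        (Polynomial.mapRingHom δ)).det := by
    intro δ
    rw [maxMinor, ← Polynomial.coe_mapRingHom, RingHom.map_det]
    rfl
  rw [hmap, hmap, RingHom.map_det]
  simp only [hentry]
  have h1 := Matrix.det_mul_column (fun k ↦ Polynomial.C (Polynomial.C (α (i.succAbove k))))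
    (Matrix.of fun k j ↦ Polynomial.C (Polynomial.C (β j)) *
      (Matrix.of fun k j ↦ scaleVars (w (-1, 0)) (w (0, -1))
        ((spreadMatrix m 𝕜 (i.succAbove k) j).map (Polynomial.mapRingHom ι))) k j)
  rw [Matrix.det_mul_row] at h1
  simp only [Matrix.of_apply] at h1
  rw [h1]
  simp only [map_mul, map_prod, mul_assoc]
  rfl

/-- The coaction multiplies the coefficients of the resultant by units. -/
lemma exists_coaction_coeff_resE (hm : Monotone m) (n : ℕ) :
    ∃ e : TorusRing 𝕜 ⊗[𝕜] ParamRing m 𝕜, IsUnit e ∧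
      coaction m 𝕜 ((resE m 𝕜).coeff n) = e * (1 ⊗ₜ (resE m 𝕜).coeff n) := by
  let ι : ParamRing m 𝕜 →+* TorusRing 𝕜 ⊗[𝕜] ParamRing m 𝕜 :=
    (Algebra.TensorProduct.includeRight : ParamRing m 𝕜 →ₐ[𝕜] _).toRingHom
  have hι : Function.Injective ι :=
    Algebra.TensorProduct.includeRight_injective (algebraMap 𝕜 (TorusRing 𝕜)).injective
  let w : ℤ × ℤ → TorusRing 𝕜 ⊗[𝕜] ParamRing m 𝕜 := fun a ↦ AddMonoidAlgebra.single a 1 ⊗ₜ 1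
  have w0 : w 0 = 1 := rfl
  have wadd : ∀ a b, w (a + b) = w a * w b := by
    intro a b
    simp [w, AddMonoidAlgebra.single_mul_single]
  have hu : ∀ a, IsUnit (w a) := fun a ↦ IsUnit.of_mul_eq_one (w (-a)) (by rw [← wadd]; simp [w0])
  have key := exists_maxMinor_map_eq m 𝕜 hm (ι := ι) (γ := (coaction m 𝕜).toRingHom) w w0 wadd
    (fun p ↦ by simp [coaction, ι, w])
  obtain ⟨e₁, he₁, h₁⟩ := key 0
  obtain ⟨e₂, he₂, h₂⟩ := key (Fin.last t)
  obtain ⟨e, he, h⟩ := exists_resultant_eq _ _ hι (hu _) (hu _) he₁ he₂ h₁ h₂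
  refine ⟨e * w (0, -1) ^ n, he.mul ((hu _).pow _), ?_⟩
  have h' := congrArg (Polynomial.coeff · n) h
  simp only [Polynomial.coeff_map, Polynomial.coeff_C_mul, coeff_scaleVar] at h'
  refine h'.trans ?_
  rw [mul_assoc, mul_comm (w _ ^ n)]
  rfl

end Torus

/-! ### Base change and locality on the target -/

/-- The universal property of the base change of a quotient of `R[y][x]`. -/
lemma existsUnique_lift_quotient_polynomial {R A Z : Type*} [CommRing R] [CommRing A] [CommRing Z]
    (ψ : R →+* A) (I : Ideal R[X][X]) (J : Ideal A[X][X])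
    (hJ : J = I.map (Polynomial.mapRingHom (Polynomial.mapRingHom ψ)))
    (f : R[X][X] ⧸ I →+* Z) (g : A →+* Z)
    (hfg : f.comp (algebraMap R (R[X][X] ⧸ I)) = g.comp ψ) :
    ∃! φ : A[X][X] ⧸ J →+* Z,
      φ.comp (Ideal.quotientMap J (Polynomial.mapRingHom (Polynomial.mapRingHom ψ))
        (hJ ▸ Ideal.le_comap_map)) = f ∧ φ.comp (algebraMap A (A[X][X] ⧸ J)) = g := by
  let ε : A[X][X] →+* Z := Polynomial.eval₂RingHom (Polynomial.eval₂RingHom g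
    (f (Ideal.Quotient.mk I (Polynomial.C Polynomial.X)))) (f (Ideal.Quotient.mk I Polynomial.X))
  have hε : ε.comp (Polynomial.mapRingHom (Polynomial.mapRingHom ψ)) =
      f.comp (Ideal.Quotient.mk I) := by
    refine Polynomial.ringHom_ext' (Polynomial.ringHom_ext' ?_ ?_) ?_
    · ext r
      have h : f (Ideal.Quotient.mk I (Polynomial.C (Polynomial.C r))) = g (ψ r) :=
        RingHom.congr_fun hfg r
      simp [ε, h]
    · simp [ε]
    · simp [ε]
  have hker : ∀ p ∈ J, ε p = 0 := by
    suffices h : J ≤ RingHom.ker ε from fun p hp ↦ h hp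
    rw [hJ, Ideal.map_le_iff_le_comap]
    intro q hq
    refine (RingHom.congr_fun hε q).trans ?_
    rw [RingHom.comp_apply, Ideal.Quotient.eq_zero_iff_mem.mpr hq, map_zero]
  refine ⟨Ideal.Quotient.lift J ε hker, ⟨?_, ?_⟩, ?_⟩
  · refine Ideal.Quotient.ringHom_ext (RingHom.ext fun p ↦ ?_)
    simpa using RingHom.congr_fun hε p
  · ext a
    change ε (Polynomial.C (Polynomial.C a)) = g a
    simp [ε]
  · rintro φ ⟨h1, h2⟩
    have h1' : ∀ p, φ (Ideal.Quotient.mk J (Polynomial.mapRingHom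
        (Polynomial.mapRingHom ψ) p)) = f (Ideal.Quotient.mk I p) :=
      fun p ↦ by rw [← h1]; rfl
    have h2' : ∀ a, φ (Ideal.Quotient.mk J (Polynomial.C (Polynomial.C a))) = g a :=
      fun a ↦ by rw [← h2]; rfl
    refine Ideal.Quotient.ringHom_ext
      (Polynomial.ringHom_ext' (Polynomial.ringHom_ext' ?_ ?_) ?_)
    · ext a
      simp [h2', ε]
    · simpa [ε] using h1' (Polynomial.C Polynomial.X)
    · simpa [ε] using h1' Polynomial.X

/-- Base change of a family of closed subschemes of the plane. -/
lemma isPushout_quotient_polynomial {R A : Type u} [CommRing R] [CommRing A] (ψ : R →+* A)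
    (I : Ideal R[X][X]) (J : Ideal A[X][X])
    (hJ : J = I.map (Polynomial.mapRingHom (Polynomial.mapRingHom ψ))) :
    IsPushout
      (CommRingCat.ofHom (algebraMap R (R[X][X] ⧸ I)))
      (CommRingCat.ofHom ψ)
      (CommRingCat.ofHom (Ideal.quotientMap J (Polynomial.mapRingHom (Polynomial.mapRingHom ψ))
        (hJ ▸ Ideal.le_comap_map)))
      (CommRingCat.ofHom (algebraMap A (A[X][X] ⧸ J))) := by
  have H (s : PushoutCocone (CommRingCat.ofHom (algebraMap R (R[X][X] ⧸ I)))
      (CommRingCat.ofHom ψ)) :=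
    existsUnique_lift_quotient_polynomial ψ I J hJ s.inl.hom s.inr.hom
      (congrArg CommRingCat.Hom.hom s.condition)
  refine ⟨⟨?_⟩, ⟨PushoutCocone.IsColimit.mk _
    (fun s ↦ CommRingCat.ofHom (H s).exists.choose) (fun s ↦ ?_) (fun s ↦ ?_) ?_⟩⟩
  · ext r
    change Ideal.Quotient.mk J (Polynomial.mapRingHom (Polynomial.mapRingHom ψ)
      (Polynomial.C (Polynomial.C r))) = Ideal.Quotient.mk J (Polynomial.C (Polynomial.C (ψ r)))
    simp
  · exact CommRingCat.hom_ext (H s).exists.choose_spec.1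
  · exact CommRingCat.hom_ext (H s).exists.choose_spec.2
  · intro s φ h1 h2
    exact CommRingCat.hom_ext ((H s).unique
      ⟨congrArg CommRingCat.Hom.hom h1, congrArg CommRingCat.Hom.hom h2⟩
      (H s).exists.choose_spec)

/-- A property which is local at the target holds over an open subscheme if it holds after
pullback to the members of an open cover of this subscheme. -/
lemma restrict_of_pullback {P : MorphismProperty Scheme.{u}} [IsZariskiLocalAtTarget P]
    {X Y : Scheme.{u}} (f : X ⟶ Y) (U : Y.Opens) {ι : Type*} {W : ι → Scheme.{u}}
    (j : ∀ i, W i ⟶ Y) [∀ i, IsOpenImmersion (j i)] (hU : U = ⨆ i, (j i).opensRange)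
    (h : ∀ i, P (pullback.snd f (j i))) : P (f ∣_ U) := by
  refine (IsZariskiLocalAtTarget.iff_of_iSup_eq_top
    (fun i ↦ U.ι ⁻¹ᵁ (j i).opensRange) ?_).mpr fun i ↦ ?_
  · rw [eq_top_iff]
    rintro x -
    obtain ⟨i, hi⟩ := TopologicalSpace.Opens.mem_iSup.mp (hU.le x.2)
    exact TopologicalSpace.Opens.mem_iSup.mpr ⟨i, hi⟩
  · have hle : (j i).opensRange ≤ U := hU ▸ le_iSup (fun i ↦ (j i).opensRange) i
    rw [P.arrow_mk_iso_iff (morphismRestrictRestrict _ _ _),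
      P.arrow_mk_iso_iff (morphismRestrictEq f (V := (j i).opensRange) 
        (by simpa [Scheme.Hom.image_preimage_eq_opensRange_inf] using hle)),
      P.arrow_mk_iso_iff (morphismRestrictOpensRange _ _)]
    exact h i

/-! ### The family over `B'` -/

section

variable {t : ℕ} (m : Fin (t + 1) → ℕ) (𝕜 : Type u) [Field 𝕜]

lemma familyMap_eq : familyMap m 𝕜 = Spec.map (CommRingCat.ofHom
    (algebraMap (ParamRing m 𝕜) ((ParamRing m 𝕜)[X][X] ⧸ minorIdeal m 𝕜))) := by
  rw [familyMap, vanishingIncl, planeProj, ← Spec.map_comp]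
  rfl

/-- The pullback is the family of minors of the localized matrix. The image of `res_E` remains in
their ideal and its `n`-th coefficient is now a unit, so `IsPencil.flat` applies. -/
lemma flat_pullback_familyMap (n : ℕ) :
    Flat (pullback.snd (familyMap m 𝕜) (Spec.map (CommRingCat.ofHom (algebraMap (ParamRing m 𝕜)
      (Localization.Away ((resE m 𝕜).coeff n)))))) := by
  let A := Localization.Away ((resE m 𝕜).coeff n)
  let ψ : ParamRing m 𝕜 →+* A := algebraMap _ _
  have hM := (isPencil_spreadMatrix m 𝕜).map (Polynomial.mapRingHom ψ)
  have hJ := map_span_rowMinor (Polynomial.mapRingHom (Polynomial.mapRingHom ψ))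
    (spreadMatrix m 𝕜)
  have hs : Polynomial.C ((resE m 𝕜).map ψ) ∈ Ideal.span (Set.range (rowMinor
      ((spreadMatrix m 𝕜).map (Polynomial.mapRingHom (Polynomial.mapRingHom ψ))))) := by
    rw [← hJ]
    have h := Ideal.mem_map_of_mem (Polynomial.mapRingHom (Polynomial.mapRingHom ψ))
      (C_resE_mem m 𝕜)
    rwa [Polynomial.coe_mapRingHom, Polynomial.map_C] at h
  have hflat := hM.flat hs (k := n) (by
    rw [Polynomial.coeff_map]
    exact IsLocalization.Away.algebraMap_isUnit _)
  have hpb := isPullback_SpecMap_of_isPushout _ _ _ _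
    (isPushout_quotient_polynomial ψ (minorIdeal m 𝕜) _ hJ.symm)
  rw [← familyMap_eq] at hpb
  rw [← hpb.isoPullback_inv_snd]
  have : Flat (Spec.map (CommRingCat.ofHom (algebraMap A (A[X][X] ⧸ Ideal.span (Set.range (rowMinor
      ((spreadMatrix m 𝕜).map (Polynomial.mapRingHom (Polynomial.mapRingHom ψ))))))))) :=
    Flat.SpecMap_iff.mpr (RingHom.flat_algebraMap_iff.mpr hflat)
  infer_instance

lemma isOpen_resLocus : IsOpen (resLocus m 𝕜) :=
  (PrimeSpectrum.isClosed_zeroLocus _).isOpen_compl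

lemma mem_resLocus (x : base m 𝕜) :
    x ∈ resLocus m 𝕜 ↔ ∃ n, (resE m 𝕜).coeff n ∉ x.asIdeal := by
  refine Iff.trans (b := ¬ Set.range (resE m 𝕜).coeff ⊆ x.asIdeal) Iff.rfl ?_
  simp only [Set.range_subset_iff, not_forall, SetLike.mem_coe]

lemma flat_familyMap_restrict :
    Flat (familyMap m 𝕜 ∣_ ⟨resLocus m 𝕜, isOpen_resLocus m 𝕜⟩) := by
  let U : (base m 𝕜).Opens := ⟨resLocus m 𝕜, isOpen_resLocus m 𝕜⟩
  let j (n : ℕ) : Spec (CommRingCat.of (Localization.Away ((resE m 𝕜).coeff n))) ⟶ base m 𝕜 :=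
    Spec.map (CommRingCat.ofHom (algebraMap (ParamRing m 𝕜) _))
  have hj : ∀ n, IsOpenImmersion (j n) := fun n ↦
    inferInstanceAs (IsOpenImmersion (Spec.map (CommRingCat.ofHom (algebraMap _ _))))
  have hrange : ∀ n x, x ∈ (j n).opensRange ↔ (resE m 𝕜).coeff n ∉ x.asIdeal := by
    intro n x
    have := PrimeSpectrum.localization_away_comap_range
      (Localization.Away ((resE m 𝕜).coeff n)) ((resE m 𝕜).coeff n)
    exact Set.ext_iff.mp this x
  have := HasRingHomProperty.instIsZariskiLocalAtTarget @Flat.{u}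
  refine restrict_of_pullback (P := @Flat) _ U j ?_ (flat_pullback_familyMap m 𝕜)
  ext x
  refine ((mem_resLocus m 𝕜 x).trans (exists_congr fun n ↦ (hrange n x).symm)).trans ?_
  exact TopologicalSpace.Opens.mem_iSup.symm

lemma isTorusStable_resLocus (hm : Monotone m) :
    IsTorusStable m 𝕜 ⟨resLocus m 𝕜, isOpen_resLocus m 𝕜⟩ := by
  intro z hz
  -- With points of `𝔾ₘ² × B` taken as primes of the tensor product, the projection and the action
  -- become contraction along `p ↦ 1 ⊗ p` and along the coaction.
  obtain ⟨z, rfl⟩ := (pullbackSpecIso 𝕜 (TorusRing 𝕜) (ParamRing m 𝕜)).inv.surjective z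
  have hz : pullback.snd (torusStr 𝕜) (baseStr m 𝕜)
      ((pullbackSpecIso 𝕜 (TorusRing 𝕜) (ParamRing m 𝕜)).inv z) ∈ resLocus m 𝕜 := hz
  change torusAction m 𝕜 ((pullbackSpecIso 𝕜 (TorusRing 𝕜) (ParamRing m 𝕜)).inv z) ∈
    resLocus m 𝕜
  rw [← Scheme.Hom.comp_apply] at hz ⊢
  rw [torusAction, Iso.inv_hom_id_assoc]
  rw [pullbackSpecIso_inv_snd] at hz
  obtain ⟨n, hn⟩ := (mem_resLocus m 𝕜 _).mp hz
  refine (mem_resLocus m 𝕜 _).mpr ⟨n, ?_⟩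
  obtain ⟨e, he, h⟩ := exists_coaction_coeff_resE m 𝕜 hm n
  change coaction m 𝕜 ((resE m 𝕜).coeff n) ∉ z.asIdeal
  change (1 : TorusRing 𝕜) ⊗ₜ[𝕜] (resE m 𝕜).coeff n ∉ z.asIdeal at hn
  rwa [h, Ideal.unit_mul_mem_iff_mem _ he]

end

end HilbertBurch

/-- For a monomial ideal `E` of finite positive colength, the locus `B'` is open, it is stable under
the torus, and `π` is flat over it. -/
theorem lemma6p2 {𝕜 : Type u} [Field 𝕜] (d : ℕ) (hd : 0 < d)
    (E : Ideal (Polynomial (Polynomial 𝕜)))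
    (hE : Module.finrank 𝕜 (Polynomial (Polynomial 𝕜) ⧸ E) = d)
    (t : ℕ) (m : Fin (t + 1) → ℕ) (hm : HilbertBurch.IsStaircase E t m) :
    ∃ hopen : IsOpen (HilbertBurch.resLocus m 𝕜),
      HilbertBurch.IsTorusStable m 𝕜 ⟨HilbertBurch.resLocus m 𝕜, hopen⟩ ∧
      Flat (HilbertBurch.familyMap m 𝕜 ∣_ ⟨HilbertBurch.resLocus m 𝕜, hopen⟩) :=
  ⟨HilbertBurch.isOpen_resLocus m 𝕜, HilbertBurch.isTorusStable_resLocus m 𝕜 hm.mono,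
    HilbertBurch.flat_familyMap_restrict m 𝕜⟩
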